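/- Let $K$ be a compact Hausdorff space, let $C(K)$ be the Banach space of real-valued continuous functions on $K$ with the sup-norm, and let $C^*(K)$ be its topological dual. Denote by $w^*$, $w$ and $\|\cdot\|$ the weak-star, the weak and the dual-norm topology on $C^*(K)$, and for a topology $\tau$ on a set $T$ let $\mathrm{Bo}(T,\tau)$ be the $\sigma$-algebra generated by the $\tau$-open sets. (1) If every subset of $K$ is a Borel set, then $\mathrm{Bo}(C^*(K),w)=\mathrm{Bo}(C^*(K),\|\cdot\|)$. (2) If $\mathrm{Bo}(C^*(K),w^*)=\mathrm{Bo}(C^*(K),w)$, then $\mathrm{Bo}(C^*(K),w^*)=\mathrm{Bo}(C^*(K),\|\cdot\|)$. (3) If $\mathrm{Bo}(C^*(K),w^*)=\mathrm{Bo}(C^*(K),\|\cdot\|)$, then every subset of $K$ is a Borel set. -/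

import Mathlib

/-- `C*(K)`: the topological dual of the Banach space `C(K)` of real-valued continuous functions
on the compact space `K`, where `C(K)` carries the sup-norm. -/
abbrev DualCK (K : Type*) [TopologicalSpace K] [CompactSpace K] : Type _ :=
  StrongDual ℝ C(K, ℝ)

/-- The topology of the dual norm on `C*(K)`. -/
noncomputable abbrev normTopology (K : Type*) [TopologicalSpace K] [CompactSpace K] :
    TopologicalSpace (DualCK K) :=
  (inferInstance : PseudoMetricSpace (DualCK K)).toUniformSpace.toTopologicalSpace

/-- The weak topology on `C*(K)`, i.e. the coarsest one for which all elements of the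
bidual are continuous. -/
noncomputable abbrev weakTopology (K : Type*) [TopologicalSpace K] [CompactSpace K] :
    TopologicalSpace (DualCK K) :=
  TopologicalSpace.induced (toWeakSpace ℝ (DualCK K)) inferInstance

/-- The weak-star topology on `C*(K)`, i.e. the coarsest one for which all evaluations
at elements of `C(K)` are continuous. -/
noncomputable abbrev weakStarTopology (K : Type*) [TopologicalSpace K] [CompactSpace K] :
    TopologicalSpace (DualCK K) :=
  TopologicalSpace.induced
    (StrongDual.toWeakDual : StrongDual ℝ C(K, ℝ) ≃ₗ[ℝ] WeakDual ℝ C(K, ℝ)) inferInstance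

/-- `Bo(T, τ)`: the σ-algebra on `T` generated by the `τ`-open sets. -/
noncomputable abbrev Bo (T : Type*) (τ : TopologicalSpace T) : MeasurableSpace T :=
  @borel T τ

/-!
For every `t : K` the Hahn-Banach theorem gives a bounded functional
`c t` on `C*(K)` with `c t (δ_s) = 1` if `s = t` and `0` otherwise, where `δ_s` is evaluation at `s`
(`exists_bidual_apply_pointEval`).

The map `s ↦ δ_s` is continuous for the weak-star topology, and for any `A : Set K` the weakly open
set `⋃ t ∈ A, {φ | c t φ ≠ 0}` pulls back to `A`. So if the weak-star and the weak Borel sets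
coincide, every subset of `K` is Borel (`measurableSet_of_borel_weakStarTopology_eq`). The third
claim follows because the weak topology lies between the other two, and the second claim is
reduced to the first.

For the first claim, let every subset of `K` be Borel. A finite regular measure `ν` without point
masses is then zero (`measure_eq_zero_of_forall_measurableSet`): there is a continuous map from `K`
to `ℕ → ℝ` with `ν`-null fibers, and the preimage of a Bernstein set and its complement contain
only null compact sets. Hence all finite regular measures are purely atomic. A functional `φ` is
dominated by the Riesz measure of its modulus (`exists_measure_abs_apply_le_integral`), so `C*(K)`
is the closed span of the `δ_t` (`mem_closure_span_pointEval`), which is isometric to `ℓ¹(K)`.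
The norm of `ℓ¹` is a Kadec norm: near `x`, closeness of the norm and of finitely many coordinates
implies closeness in norm (`exists_finset_kadec`). Since balls are weakly closed, this
makes every norm-open set a countable union of weakly Borel sets (`borel_eq_of_kadec`).
-/

universe u

/-! ### Bernstein sets -/

open Cardinal in
/-- Transfinite choice of pairwise distinct representatives: at each stage of a well-order of
minimal type, fewer than `#ι` points have been used, so `S i` still has an unused one. -/
theorem exists_injective_forall_mem_of_mk_le {ι X : Type u} (S : ι → Set X)
    (hS : ∀ i, #ι ≤ #(S i)) : ∃ f : ι → X, Function.Injective f ∧ ∀ i, f i ∈ S i := by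
  classical
  obtain ⟨r, hr, hord⟩ := Cardinal.exists_ord_eq ι
  have key : ∀ (i : ι) (g : ∀ j, r j i → X), ∃ x ∈ S i, ∀ j (h : r j i), g j h ≠ x := by
    intro i g
    by_contra! hcon
    have h1 : S i ⊆ Set.range (fun p : {j // r j i} => g p.1 p.2) := by
      intro x hx
      obtain ⟨j, h, e⟩ := hcon x hx
      exact ⟨⟨j, h⟩, e⟩
    have h2 : #{j // r j i} < #ι := by
      have := Ordinal.typein_lt_type r i
      rw [← hord, Cardinal.lt_ord] at this
      simpa using this
    exact absurd (((hS i).trans (mk_le_mk_of_subset h1)).trans mk_range_le) (not_le.2 h2)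
  choose F hF hne using key
  let f : ι → X := hr.wf.fix F
  have hf : ∀ i, f i = F i (fun j _ => f j) := fun i => hr.wf.fix_eq F i
  refine ⟨f, ?_, fun i => by rw [hf]; exact hF _ _⟩
  intro i j hij
  rcases trichotomous_of r i j with h | h | h
  · exact absurd (hij.trans (hf j)) (hne j (fun k _ => f k) i h)
  · exact h
  · exact absurd (hij.symm.trans (hf i)) (hne i (fun k _ => f k) j h)

open Cardinal in
/-- A Polish space contains a Bernstein set: neither the set nor its complement includes an
uncountable closed set. -/
theorem exists_bernstein_set (X : Type u) [TopologicalSpace X] [PolishSpace X] :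
    ∃ A : Set X, ∀ C : Set X, IsClosed C → (C ⊆ A ∨ C ⊆ Aᶜ) → C.Countable := by
  let I := {C : Set X // IsClosed C ∧ ¬ C.Countable}
  have hI : #I ≤ 𝔠 := by
    let : MeasurableSpace X := borel X
    have : BorelSpace X := ⟨rfl⟩
    have h1 : #{t : Set X | @MeasurableSet X (MeasurableSpace.generateFrom
        (MeasurableSpace.countableGeneratingSet X)) t} ≤ 𝔠 :=
      MeasurableSpace.cardinal_measurableSet_le_continuum
        ((MeasurableSpace.countable_countableGeneratingSet (α := X)).le_aleph0.trans
          aleph0_le_continuum)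
    rw [MeasurableSpace.generateFrom_countableGeneratingSet] at h1
    refine le_trans
      (mk_le_mk_of_subset (s := {C : Set X | IsClosed C ∧ ¬ C.Countable}) ?_) h1
    exact fun C hC => hC.1.measurableSet
  have hIB : #(I × Bool) ≤ 𝔠 := by
    rw [mk_prod, lift_uzero, mk_bool]
    exact (mul_le_mul' hI le_rfl).trans (by simp)
  have hcard : ∀ p : I × Bool, #(I × Bool) ≤ #p.1.1 := by
    rintro ⟨⟨C, hC, hu⟩, b⟩
    obtain ⟨f, hfC, -, hinj⟩ := hC.exists_nat_bool_injection_of_not_countable hu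
    refine hIB.trans ?_
    have := mk_le_of_injective (α := ULift.{u} (ℕ → Bool)) (β := C)
      (f := fun x => ⟨f x.down, hfC ⟨x.down, rfl⟩⟩)
      fun x y h => ULift.ext _ _ (hinj (congrArg Subtype.val h))
    simpa using this
  -- Two distinct points are chosen in every uncountable closed set; the first ones form `A`.
  obtain ⟨f, hinj, hf⟩ := exists_injective_forall_mem_of_mk_le (fun p : I × Bool => p.1.1) hcard
  refine ⟨Set.range fun i => f (i, true), fun C hC h => ?_⟩
  by_contra hu
  rcases h with h | h
  · obtain ⟨i, hi⟩ := h (hf (⟨C, hC, hu⟩, false))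
    simpa using hinj hi
  · exact h (hf (⟨C, hC, hu⟩, true)) ⟨_, rfl⟩

/-! ### Regular measures when every subset is Borel -/

open MeasureTheory Set in
/-- By outer regularity and compactness, `K` has for every `n` a finite cover by sets
`{x | 1 / 2 < f x}` of measure at most `1 / (n + 1)`; the countably many functions `f` together
form a map to a Polish space whose fibers are null. -/
theorem exists_continuous_measure_fiber_eq_zero {K : Type*} [TopologicalSpace K] [CompactSpace K]
    [T2Space K] [MeasurableSpace K] (ν : Measure K) [ν.OuterRegular] (h0 : ∀ x, ν {x} = 0) :
    ∃ F : K → ℕ → ℝ, Continuous F ∧ ∀ c, ν (F ⁻¹' {c}) = 0 := by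
  have key : ∀ n : ℕ, ∃ S : Set C(K, ℝ), S.Finite ∧ (∀ x, ∃ f ∈ S, 1 / 2 < f x) ∧
      ∀ f ∈ S, ν {x | 1 / 2 < f x} ≤ ((n + 1 : ℕ) : ENNReal)⁻¹ := by
    intro n
    have h1 : ∀ x : K, ∃ f : C(K, ℝ), 1 / 2 < f x ∧
        ν {x | 1 / 2 < f x} ≤ ((n + 1 : ℕ) : ENNReal)⁻¹ := by
      intro x
      obtain ⟨U, hxU, hU, hνU⟩ := ({x} : Set K).exists_isOpen_lt_of_lt (μ := ν)
        ((n + 1 : ℕ) : ENNReal)⁻¹ (by rw [h0]; exact ENNReal.inv_pos.2 (ENNReal.natCast_ne_top _))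
      obtain ⟨f, hf0, hf1, -⟩ := exists_continuous_zero_one_of_isClosed hU.isClosed_compl
        (isClosed_singleton (x := x)) (by simpa using hxU)
      refine ⟨f, ?_, (measure_mono ?_).trans hνU.le⟩
      · rw [hf1 rfl]; norm_num
      · intro y hy
        by_contra hyU
        have := hf0 hyU
        simp only [mem_ofPred_eq, this, Pi.zero_apply] at hy
        norm_num at hy
    choose f hfx hfν using h1
    obtain ⟨t, ht⟩ := isCompact_univ.elim_finite_subcover (fun x => {y | 1 / 2 < f x y})
      (fun x => isOpen_lt continuous_const (f x).continuous) fun x _ => mem_iUnion.2 ⟨x, hfx x⟩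
    refine ⟨f '' t, t.finite_toSet.image _, fun x => ?_, ?_⟩
    · obtain ⟨y, hy, h⟩ := mem_iUnion₂.1 (ht (mem_univ x))
      exact ⟨f y, ⟨y, hy, rfl⟩, h⟩
    · rintro _ ⟨y, -, rfl⟩
      exact hfν y
  choose S hfin hcov hS using key
  rcases isEmpty_or_nonempty K with hK | ⟨⟨x₀⟩⟩
  · exact ⟨fun _ _ => 0, continuous_const, fun c => by simp [Set.eq_empty_of_isEmpty]⟩
  obtain ⟨g, hg⟩ := (countable_iUnion fun n => (hfin n).countable).exists_eq_range
    ((hcov 0 x₀).imp fun f hf => mem_iUnion.2 ⟨0, hf.1⟩)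
  refine ⟨fun x k => g k x, continuous_pi fun k => (g k).continuous, fun c => ?_⟩
  rcases eq_empty_or_nonempty ((fun x k => g k x) ⁻¹' {c}) with h | ⟨x, hx⟩
  · rw [h, measure_empty]
  refine le_antisymm (ge_of_tendsto'
    (ENNReal.tendsto_inv_nat_nhds_zero.comp (Filter.tendsto_add_atTop_nat 1)) fun n => ?_) zero_le
  obtain ⟨f, hf, hfx⟩ := hcov n x
  obtain ⟨k, rfl⟩ : f ∈ range g := hg ▸ mem_iUnion.2 ⟨n, hf⟩
  refine (measure_mono fun y hy => ?_).trans (hS n _ hf)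
  have : g k y = g k x := (congrFun hy k).trans (congrFun hx k).symm
  simpa [this] using hfx

open MeasureTheory Set in
/-- Let `F` map `K` continuously to a Polish space, with null fibers, and let `A` be a Bernstein
set there. A compact subset of `F ⁻¹' A` has a compact image inside `A`; the image is countable,
so the compact set is null. Hence `F ⁻¹' A` is null by inner regularity, and so is its
complement. -/
theorem measure_eq_zero_of_forall_measurableSet {K : Type*} [TopologicalSpace K] [CompactSpace K]
    [T2Space K] [MeasurableSpace K] [BorelSpace K] (hK : ∀ A : Set K, MeasurableSet A)
    (ν : Measure K) [IsFiniteMeasure ν] [ν.Regular] (h0 : ∀ x, ν {x} = 0) : ν = 0 := by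
  obtain ⟨F, hF, hfib⟩ := exists_continuous_measure_fiber_eq_zero ν h0
  obtain ⟨A, hA⟩ := exists_bernstein_set (ℕ → ℝ)
  have key : ∀ B : Set (ℕ → ℝ), (∀ C : Set (ℕ → ℝ), IsClosed C → C ⊆ B → C.Countable) →
      ν (F ⁻¹' B) = 0 := by
    intro B hB
    rw [(hK (F ⁻¹' B)).measure_eq_iSup_isCompact_of_ne_top (measure_ne_top _ _)]
    simp only [ENNReal.iSup_eq_zero]
    intro C hCB hC
    have hcount := hB (F '' C) (hC.image hF).isClosed (image_subset_iff.2 hCB)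
    refine measure_mono_null (t := ⋃ c ∈ F '' C, F ⁻¹' {c}) ?_
      ((measure_biUnion_null_iff hcount).2 fun c _ => hfib c)
    exact fun x hx => mem_iUnion₂.2 ⟨F x, mem_image_of_mem F hx, rfl⟩
  rw [← Measure.measure_univ_eq_zero, ← union_compl_self (F ⁻¹' A), measure_union_null_iff]
  exact ⟨key A fun C hC h => hA C hC (Or.inl h), key Aᶜ fun C hC h => hA C hC (Or.inr h)⟩

open MeasureTheory Set in
/-- If every subset is Borel, a finite regular measure is purely atomic, hence concentrated on a
finite set up to `ε`. -/
theorem exists_finset_measure_compl_lt {K : Type*} [TopologicalSpace K] [CompactSpace K]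
    [T2Space K] [MeasurableSpace K] [BorelSpace K] (hK : ∀ A : Set K, MeasurableSet A)
    (μ : Measure K) [IsFiniteMeasure μ] [μ.Regular] {ε : ENNReal} (hε : 0 < ε) :
    ∃ F : Finset K, μ (F : Set K)ᶜ < ε := by
  let D : Set K := {x | 0 < μ {x}}
  have hD : D.Countable := Measure.countable_meas_pos_of_disjoint_iUnion
    (fun x => measurableSet_singleton x) fun x y h => by simpa using h
  have hDc : μ Dᶜ = 0 := by
    have : (μ.restrict Dᶜ).Regular := inferInstance
    rw [← Measure.restrict_eq_zero]
    refine measure_eq_zero_of_forall_measurableSet hK _ fun x => ?_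
    rw [Measure.restrict_apply (hK _)]
    by_cases hx : x ∈ D
    · rw [singleton_inter_eq_empty.2 (by simpa using hx), measure_empty]
    · exact measure_mono_null inter_subset_left (by simpa [D] using hx)
  rcases D.eq_empty_or_nonempty with h | h
  · exact ⟨∅, by rwa [Finset.coe_empty, ← h, hDc]⟩
  obtain ⟨d, hd⟩ := hD.exists_eq_range h
  classical
  have hlim := tendsto_measure_iInter_atTop (μ := μ)
    (s := fun n => ((Finset.range n).image d : Set K)ᶜ) (fun n => (hK _).nullMeasurableSet)
    (fun m n hmn => compl_subset_compl.2 (by gcongr)) ⟨0, measure_ne_top _ _⟩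
  have hz : μ (⋂ n, ((Finset.range n).image d : Set K)ᶜ) = 0 := by
    refine measure_mono_null (fun x hx => ?_) hDc
    rw [hd]
    rintro ⟨n, rfl⟩
    exact mem_iInter.1 hx (n + 1) (by simpa using ⟨n, le_rfl, rfl⟩)
  rw [hz] at hlim
  obtain ⟨n, hn⟩ := (hlim.eventually_lt_const hε).exists
  exact ⟨_, hn⟩

/-! ### The modulus of a functional on `C(K)` -/

/-- The modulus `|φ|` of a functional `φ`, with the value `sup {φ g | |g| ≤ f}` at `f`; it is
meaningful for `f ≥ 0` only. -/
noncomputable def dualModulus {K : Type*} [TopologicalSpace K] [CompactSpace K] (φ : DualCK K)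
    (f : C(K, ℝ)) : ℝ :=
  sSup (φ '' {g | ∀ x, |g x| ≤ f x})

theorem le_dualModulus {K : Type*} [TopologicalSpace K] [CompactSpace K] (φ : DualCK K)
    {f g : C(K, ℝ)} (h : ∀ x, |g x| ≤ f x) : φ g ≤ dualModulus φ f := by
  refine le_csSup ⟨‖φ‖ * ‖f‖, ?_⟩ ⟨g, h, rfl⟩
  rintro _ ⟨g, hg, rfl⟩
  refine (le_abs_self _).trans ((φ.le_opNorm g).trans ?_)
  gcongr
  exact (ContinuousMap.norm_le _ (norm_nonneg _)).2 fun x =>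
    (hg x).trans ((le_abs_self _).trans (f.norm_coe_le_norm x))

theorem dualModulus_le {K : Type*} [TopologicalSpace K] [CompactSpace K] (φ : DualCK K)
    {f : C(K, ℝ)} (hf : 0 ≤ f) {b : ℝ} (h : ∀ g : C(K, ℝ), (∀ x, |g x| ≤ f x) → φ g ≤ b) :
    dualModulus φ f ≤ b := by
  refine csSup_le ⟨φ 0, 0, fun x => by simpa using hf x, rfl⟩ ?_
  rintro _ ⟨g, hg, rfl⟩
  exact h g hg

theorem dualModulus_nonneg {K : Type*} [TopologicalSpace K] [CompactSpace K] (φ : DualCK K)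
    {f : C(K, ℝ)} (hf : 0 ≤ f) : 0 ≤ dualModulus φ f := by
  simpa using le_dualModulus φ (f := f) (g := 0) fun x => by simpa using hf x

/-- Additivity is the Riesz decomposition: if `|g| ≤ f₁ + f₂`, the truncation of `g` to
`[-f₁, f₁]` differs from `g` by at most `f₂`. -/
theorem dualModulus_add {K : Type*} [TopologicalSpace K] [CompactSpace K] (φ : DualCK K)
    {f₁ f₂ : C(K, ℝ)} (h₁ : 0 ≤ f₁) (h₂ : 0 ≤ f₂) :
    dualModulus φ (f₁ + f₂) = dualModulus φ f₁ + dualModulus φ f₂ := by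
  apply le_antisymm
  · refine dualModulus_le φ (add_nonneg h₁ h₂) fun g hg => ?_
    let g₁ : C(K, ℝ) := (g ⊓ f₁) ⊔ (-f₁)
    have e : φ g = φ g₁ + φ (g - g₁) := by rw [← map_add, add_sub_cancel]
    have hx : ∀ x, |g₁ x| ≤ f₁ x ∧ |(g - g₁) x| ≤ f₂ x := by
      intro x
      have a1 : 0 ≤ f₁ x := h₁ x
      have a2 : 0 ≤ f₂ x := h₂ x
      have a3 : |g x| ≤ f₁ x + f₂ x := hg x
      have a4 : g₁ x = max (min (g x) (f₁ x)) (-f₁ x) := rfl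
      rw [ContinuousMap.sub_apply, a4]
      rw [abs_le] at a3 ⊢
      rw [abs_le]
      rcases min_cases (g x) (f₁ x) with ⟨h, _⟩ | ⟨h, _⟩ <;> rw [h] <;>
      rcases max_cases (g x) (-f₁ x) with ⟨h', _⟩ | ⟨h', _⟩ <;>
      rcases max_cases (f₁ x) (-f₁ x) with ⟨h'', _⟩ | ⟨h'', _⟩ <;>
      simp only [h', h''] <;> refine ⟨⟨?_, ?_⟩, ?_, ?_⟩ <;> linarith [a3.1, a3.2]
    rw [e]
    exact add_le_add (le_dualModulus φ fun x => (hx x).1) (le_dualModulus φ fun x => (hx x).2)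
  · rw [← le_sub_iff_add_le]
    refine dualModulus_le φ h₁ fun g₁ hg₁ => ?_
    rw [le_sub_comm]
    refine dualModulus_le φ h₂ fun g₂ hg₂ => ?_
    rw [le_sub_iff_add_le', ← map_add]
    exact le_dualModulus φ fun x => (abs_add_le _ _).trans (add_le_add (hg₁ x) (hg₂ x))

theorem dualModulus_smul {K : Type*} [TopologicalSpace K] [CompactSpace K] (φ : DualCK K)
    {c : ℝ} (hc : 0 ≤ c) {f : C(K, ℝ)} (hf : 0 ≤ f) :
    dualModulus φ (c • f) = c * dualModulus φ f := by
  have key : ∀ {c : ℝ}, 0 < c → ∀ {f : C(K, ℝ)}, 0 ≤ f →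
      dualModulus φ (c • f) ≤ c * dualModulus φ f := by
    intro c hc f hf
    refine dualModulus_le φ (smul_nonneg hc.le hf) fun g hg => ?_
    have : φ (c⁻¹ • g) ≤ dualModulus φ f := by
      refine le_dualModulus φ fun x => ?_
      have := hg x
      simp only [ContinuousMap.smul_apply, smul_eq_mul, abs_mul, abs_inv, abs_of_pos hc] at this ⊢
      rwa [inv_mul_le_iff₀ hc]
    rwa [map_smul, smul_eq_mul, inv_mul_le_iff₀ hc] at this
  rcases hc.eq_or_lt with rfl | hc
  · have h0 := dualModulus_add φ (le_refl (0 : C(K, ℝ))) le_rfl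
    rw [add_zero, left_eq_add] at h0
    rw [zero_smul, zero_mul, h0]
  · refine le_antisymm (key hc hf) ?_
    have := key (inv_pos.2 hc) (smul_nonneg hc.le hf)
    rwa [inv_smul_smul₀ hc.ne', le_inv_mul_iff₀ hc] at this

open CompactlySupported in
/-- The real-valued function underlying a nonnegative one. -/
def realOfNNReal {K : Type*} [TopologicalSpace K] (f : C_c(K, NNReal)) : C(K, ℝ) :=
  ⟨fun x => (f x : ℝ), by fun_prop⟩

open CompactlySupported MeasureTheory in
/-- The Riesz measure of the modulus dominates the functional. -/
theorem exists_measure_abs_apply_le_integral {K : Type*} [TopologicalSpace K] [CompactSpace K]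
    [T2Space K] [MeasurableSpace K] [BorelSpace K] (φ : DualCK K) :
    ∃ μ : Measure K, IsFiniteMeasure μ ∧ μ.Regular ∧ ∀ g : C(K, ℝ), |φ g| ≤ ∫ x, |g x| ∂μ := by
  have hpos : ∀ f : C_c(K, NNReal), 0 ≤ realOfNNReal f := fun f x => (f x).2
  let Λ : C_c(K, NNReal) →ₗ[NNReal] NNReal :=
    { toFun := fun f => ⟨dualModulus φ (realOfNNReal f), dualModulus_nonneg φ (hpos f)⟩
      map_add' := fun f g => NNReal.eq (dualModulus_add φ (hpos f) (hpos g))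
      map_smul' := fun c f => NNReal.eq (dualModulus_smul φ c.2 (hpos f)) }
  refine ⟨NNRealRMK.rieszMeasure Λ, inferInstance, inferInstance, fun g => ?_⟩
  let f : C_c(K, NNReal) := ⟨⟨fun x => ‖g x‖₊, by fun_prop⟩, HasCompactSupport.of_compactSpace _⟩
  have h := NNRealRMK.integral_rieszMeasure Λ f
  change ∫ x, |g x| ∂_ = dualModulus φ (realOfNNReal f) at h
  rw [h]
  refine abs_le'.2 ⟨le_dualModulus φ fun x => le_rfl, ?_⟩
  rw [← map_neg]
  exact le_dualModulus φ fun x => (abs_neg _).le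

/-! ### Point evaluations in `C*(K)` -/

open Set in
theorem exists_bump_functions {K : Type*} [TopologicalSpace K] [CompactSpace K] [T2Space K]
    [DecidableEq K] (F : Finset K) :
    ∃ h : K → C(K, ℝ), (∀ t x, 0 ≤ h t x) ∧ (∀ x, ∑ t ∈ F, h t x ≤ 1) ∧
      ∀ s ∈ F, ∀ t ∈ F, h t s = if t = s then 1 else 0 := by
  have key : ∀ t : K, ∃ f : C(K, ℝ), (∀ s ∈ F, f s = if t = s then 1 else 0) ∧ ∀ x, 0 ≤ f x := by
    intro t
    obtain ⟨f, hf0, hf1, hf⟩ := exists_continuous_zero_one_of_isClosed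
      ((F.erase t).finite_toSet.isClosed) (isClosed_singleton (x := t)) (by simp)
    refine ⟨f, fun s hs => ?_, fun x => (hf x).1⟩
    split_ifs with h
    · subst h; exact hf1 rfl
    · exact hf0 (by simpa [hs] using Ne.symm h)
  choose f hf hf0 using key
  -- Dividing by `max 1 (∑ f t)` bounds the sum by `1` without changing the values on `F`.
  let m : C(K, ℝ) := 1 ⊔ ∑ t ∈ F, f t
  have hm : ∀ x, m x = max 1 (∑ t ∈ F, f t x) := fun x => by simp [m]
  have hm0 : ∀ x, 0 < m x := fun x => by rw [hm]; positivity
  refine ⟨fun t => ⟨fun x => f t x / m x, (f t).continuous.div m.continuous fun x => (hm0 x).ne'⟩,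
    fun t x => div_nonneg (hf0 t x) (hm0 x).le, fun x => ?_, fun s hs t ht => ?_⟩
  · simp only [ContinuousMap.coe_mk]
    rw [← Finset.sum_div, div_le_one (hm0 x), hm]
    exact le_max_right _ _
  · have h1 : m s = 1 := by
      rw [hm, Finset.sum_congr rfl fun t _ => hf t s hs]
      simp [hs]
    simp only [ContinuousMap.coe_mk]
    rw [h1, div_one, hf t s hs]

/-- The point evaluation `δ_t` as an element of the dual. -/
noncomputable abbrev pointEval {K : Type*} [TopologicalSpace K] [CompactSpace K] (t : K) :
    DualCK K :=
  ContinuousMap.evalCLM ℝ t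

open Set MeasureTheory in
/-- With `F` finite of small co-measure for a measure dominating `φ`, and bump functions `h` for
`F`, the functional `φ` is close to `∑ t ∈ F, φ (h t) • δ_t`. -/
theorem mem_closure_span_pointEval {K : Type*} [TopologicalSpace K] [CompactSpace K] [T2Space K]
    (hK : ∀ A : Set K, @MeasurableSet K (borel K) A) (φ : DualCK K) :
    φ ∈ closure (Submodule.span ℝ (range (pointEval (K := K))) : Set (DualCK K)) := by
  classical
  let : MeasurableSpace K := borel K
  have : BorelSpace K := ⟨rfl⟩
  obtain ⟨μ, hfin, hreg, hμ⟩ := exists_measure_abs_apply_le_integral φ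
  refine (SeminormedAddCommGroup.mem_closure_iff (E := DualCK K)).2 fun ε hε => ?_
  obtain ⟨F, hF⟩ := exists_finset_measure_compl_lt hK μ (ε := ENNReal.ofReal (ε / 2)) (by simpa)
  have hF' : μ.real (F : Set K)ᶜ < ε / 2 := by
    rwa [Measure.real, ← ENNReal.lt_ofReal_iff_toReal_lt (measure_ne_top _ _)]
  obtain ⟨h, h0, h1, hd⟩ := exists_bump_functions F
  refine ⟨∑ t ∈ F, φ (h t) • pointEval t, Submodule.sum_mem _ fun t _ =>
    Submodule.smul_mem _ _ (Submodule.subset_span (mem_range_self t)), ?_⟩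
  refine lt_of_le_of_lt (ContinuousLinearMap.opNorm_le_bound _
    (by positivity : 0 ≤ 2 * μ.real (F : Set K)ᶜ) fun g => ?_) (by linarith)
  let k : C(K, ℝ) := g - ∑ t ∈ F, g t • h t
  have hk : ∀ x, k x = g x - ∑ t ∈ F, g t * h t x := fun x => by simp [k]
  have e : (φ - ∑ t ∈ F, φ (h t) • pointEval t) g = φ k := by
    simp [k, mul_comm]
  have hkF : ∀ x ∈ F, k x = 0 := by
    intro x hx
    rw [hk, Finset.sum_congr rfl fun t ht => by rw [hd x hx t ht]]
    simp [hx]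
  have hkb : ∀ x, |k x| ≤ 2 * ‖g‖ := by
    intro x
    have : |∑ t ∈ F, g t * h t x| ≤ ‖g‖ := by
      refine (Finset.abs_sum_le_sum_abs _ _).trans ?_
      calc ∑ t ∈ F, |g t * h t x| ≤ ∑ t ∈ F, ‖g‖ * h t x := by
            gcongr with t
            rw [abs_mul, abs_of_nonneg (h0 t x)]
            exact mul_le_mul_of_nonneg_right (g.norm_coe_le_norm t) (h0 t x)
        _ ≤ ‖g‖ := by
            rw [← Finset.mul_sum]
            exact mul_le_of_le_one_right (norm_nonneg _) (h1 x)
    rw [hk, two_mul]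
    exact (abs_sub _ _).trans (add_le_add (g.norm_coe_le_norm x) this)
  rw [e, Real.norm_eq_abs]
  calc |φ k| ≤ ∫ x, |k x| ∂μ := hμ k
    _ = ∫ x in (F : Set K)ᶜ, |k x| ∂μ := by
        refine (setIntegral_eq_integral_of_forall_compl_eq_zero fun x hx => ?_).symm
        rw [hkF x (by simpa using hx), abs_zero]
    _ ≤ ∫ x in (F : Set K)ᶜ, 2 * ‖g‖ ∂μ :=
        integral_mono_of_nonneg (ae_of_all _ fun x => abs_nonneg _) (integrable_const _)
          (ae_of_all _ hkb)
    _ = 2 * μ.real (F : Set K)ᶜ * ‖g‖ := by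
        rw [setIntegral_const, smul_eq_mul]; ring

open Set in
/-- Hahn-Banach: `δ_t` has distance at least `1` from the span of the other evaluations. -/
theorem exists_bidual_apply_pointEval {K : Type*} [TopologicalSpace K] [CompactSpace K] [T2Space K]
    [DecidableEq K] (t : K) :
    ∃ c : StrongDual ℝ (DualCK K), ∀ s, c (pointEval s) = if s = t then 1 else 0 := by
  let p : Submodule ℝ (DualCK K) := Submodule.span ℝ (pointEval '' {t}ᶜ)
  have hp : ∀ y ∈ p, ∃ F : Finset K, t ∉ F ∧ ∀ g : C(K, ℝ), (∀ s ∈ F, g s = 0) → y g = 0 := by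
    intro y hy
    induction hy using Submodule.span_induction with
    | mem y hy =>
      obtain ⟨s, hs, rfl⟩ := hy
      exact ⟨{s}, by simpa using Ne.symm hs, fun g hg => hg s (by simp)⟩
    | zero => exact ⟨∅, by simp, fun g _ => rfl⟩
    | add y z _ _ hy hz =>
      obtain ⟨F, hF, h⟩ := hy
      obtain ⟨G, hG, h'⟩ := hz
      refine ⟨F ∪ G, by simp [hF, hG], fun g hg => ?_⟩
      rw [add_apply, h g fun s hs => hg s (by simp [hs]),
        h' g fun s hs => hg s (by simp [hs]), add_zero]
    | smul a y _ hy =>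
      obtain ⟨F, hF, h⟩ := hy
      exact ⟨F, hF, fun g hg => by rw [smul_apply, h g hg, smul_zero]⟩
  have hdist : pointEval t ∉ p.topologicalClosure := by
    intro hmem
    obtain ⟨y, hy, hlt⟩ := (SeminormedAddCommGroup.mem_closure_iff (E := DualCK K)).1 hmem 1 one_pos
    obtain ⟨F, hF, h⟩ := hp y hy
    obtain ⟨g, hg0, hg1, hg⟩ := exists_continuous_zero_one_of_isClosed F.finite_toSet.isClosed
      (isClosed_singleton (x := t)) (by simpa using hF)
    have hgn : ‖g‖ ≤ 1 := (ContinuousMap.norm_le _ zero_le_one).2 fun x => by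
      rw [Real.norm_eq_abs, abs_of_nonneg (hg x).1]
      exact (hg x).2
    have h1 : (pointEval t - y) g = 1 := by
      rw [sub_apply, h g hg0, sub_zero]
      exact hg1 rfl
    have h2 := (pointEval t - y).le_of_opNorm_le_of_le le_rfl hgn
    rw [h1, norm_one, mul_one] at h2
    exact absurd hlt (not_lt.2 h2)
  obtain ⟨f, u, hft, hfu⟩ := geometric_hahn_banach_point_closed
    p.topologicalClosure.convex p.isClosed_topologicalClosure hdist
  have hf0 : ∀ b ∈ p, f b = 0 := by
    -- A linear functional bounded below on a subspace vanishes there.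
    intro b hb
    by_contra hne
    have := hfu (((u - 1) / f b) • b) (p.le_topologicalClosure (p.smul_mem _ hb))
    rw [map_smul, smul_eq_mul, div_mul_cancel₀ _ hne] at this
    linarith
  have hu : u < 0 := by simpa using hfu 0 (zero_mem _)
  refine ⟨(f (pointEval t))⁻¹ • f, fun s => ?_⟩
  rw [smul_apply, smul_eq_mul]
  split_ifs with h
  · rw [h, inv_mul_cancel₀ (by linarith)]
  · rw [hf0 _ (Submodule.subset_span ⟨s, h, rfl⟩), mul_zero]

/-- The functional attains `∑ |a t|` on a function with values `sign (a t)` on `F`. -/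
theorem sum_abs_le_norm_sum_pointEval {K : Type*} [TopologicalSpace K] [CompactSpace K]
    [T2Space K] (F : Finset K) (a : K → ℝ) :
    ∑ t ∈ F, |a t| ≤ ‖∑ t ∈ F, a t • (pointEval t : DualCK K)‖ := by
  classical
  obtain ⟨h, h0, h1, hd⟩ := exists_bump_functions F
  let g : C(K, ℝ) := ∑ t ∈ F, (SignType.sign (a t) : ℝ) • h t
  have hg : ∀ x, g x = ∑ t ∈ F, (SignType.sign (a t) : ℝ) * h t x := fun x => by simp [g]
  have hgn : ‖g‖ ≤ 1 := by
    refine (ContinuousMap.norm_le _ zero_le_one).2 fun x => ?_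
    rw [hg]
    refine (norm_sum_le _ _).trans (le_trans (Finset.sum_le_sum fun t _ => ?_) (h1 x))
    rw [norm_mul, Real.norm_eq_abs (h t x), abs_of_nonneg (h0 t x)]
    refine mul_le_of_le_one_left (h0 t x) ?_
    rcases SignType.sign (a t) with _ | _ | _ <;> simp
  have hgF : ∀ s ∈ F, g s = SignType.sign (a s) := by
    intro s hs
    rw [hg, Finset.sum_congr rfl fun t ht => by rw [hd s hs t ht]]
    simp [hs]
  have e : (∑ t ∈ F, a t • (pointEval t : DualCK K)) g = ∑ t ∈ F, |a t| := by
    simp only [sum_apply, smul_apply, smul_eq_mul,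
      ContinuousMap.evalCLM_apply]
    exact Finset.sum_congr rfl fun t ht => by rw [hgF t ht, self_mul_sign]
  rw [← e]
  refine (le_abs_self _).trans ?_
  simpa using (∑ t ∈ F, a t • (pointEval t : DualCK K)).le_of_opNorm_le_of_le le_rfl hgn

theorem norm_pointEval_le {K : Type*} [TopologicalSpace K] [CompactSpace K] (t : K) :
    ‖(pointEval t : DualCK K)‖ ≤ 1 :=
  ContinuousLinearMap.opNorm_le_bound _ zero_le_one fun g => by
    rw [one_mul]
    exact g.norm_coe_le_norm t

/-! ### The Kadec property of the norm of `ℓ¹` -/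

theorem norm_sum_smul_le_sum_abs {ι E : Type*} [NormedAddCommGroup E] [NormedSpace ℝ E]
    {d : ι → E} (hd : ∀ t, ‖d t‖ ≤ 1) (F : Finset ι) (a : ι → ℝ) :
    ‖∑ t ∈ F, a t • d t‖ ≤ ∑ t ∈ F, |a t| := by
  refine (norm_sum_le _ _).trans (Finset.sum_le_sum fun t _ => ?_)
  rw [norm_smul, Real.norm_eq_abs]
  exact mul_le_of_le_one_right (abs_nonneg _) (hd t)

/-- The norm on the closed span of an isometric copy of the unit vectors of `ℓ¹` is additive over
disjoint supports. -/
theorem sum_abs_add_norm_sub_le {ι E : Type*} [NormedAddCommGroup E] [NormedSpace ℝ E]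
    [DecidableEq ι] {d : ι → E} {c : ι → StrongDual ℝ E}
    (hc : ∀ t s, c t (d s) = if s = t then 1 else 0) (hd : ∀ t, ‖d t‖ ≤ 1)
    (hsum : ∀ (F : Finset ι) (a : ι → ℝ), ∑ t ∈ F, |a t| ≤ ‖∑ t ∈ F, a t • d t‖)
    (F : Finset ι) {y : E} (hy : y ∈ closure (Submodule.span ℝ (Set.range d) : Set E)) :
    ∑ t ∈ F, |c t y| + ‖y - ∑ t ∈ F, c t y • d t‖ ≤ ‖y‖ := by
  have hclosed : IsClosed {y : E | ∑ t ∈ F, |c t y| + ‖y - ∑ t ∈ F, c t y • d t‖ ≤ ‖y‖} :=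
    isClosed_le (by fun_prop) (by fun_prop)
  refine closure_minimal (fun y hy => ?_) hclosed hy
  obtain ⟨a, rfl⟩ := Finsupp.mem_span_range_iff_exists_finsupp.1 hy
  have ha : (a.sum fun t r => r • d t) = ∑ t ∈ F ∪ a.support, a t • d t :=
    Finset.sum_subset Finset.subset_union_right fun t _ ht => by
      simp [Finsupp.notMem_support_iff.1 ht]
  rw [ha]
  generalize hG : F ∪ a.support = G
  have hFG : F ⊆ G := hG ▸ Finset.subset_union_left
  have hca : ∀ t ∈ F, c t (∑ t ∈ G, a t • d t) = a t := by
    intro t ht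
    simp [map_sum, hc, hFG ht]
  have e1 : ∑ t ∈ F, |c t (∑ t ∈ G, a t • d t)| = ∑ t ∈ F, |a t| :=
    Finset.sum_congr rfl fun t ht => by rw [hca t ht]
  have e2 : ∑ t ∈ F, c t (∑ t ∈ G, a t • d t) • d t = ∑ t ∈ F, a t • d t :=
    Finset.sum_congr rfl fun t ht => by rw [hca t ht]
  rw [Set.mem_ofPred_eq, e1, e2]
  calc _ = ∑ t ∈ F, |a t| + ‖∑ t ∈ G \ F, a t • d t‖ := by
        rw [← Finset.sum_sdiff hFG, add_sub_cancel_right]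
    _ ≤ ∑ t ∈ F, |a t| + ∑ t ∈ G \ F, |a t| := by
        gcongr
        exact norm_sum_smul_le_sum_abs hd _ _
    _ = ∑ t ∈ G, |a t| := by
        rw [add_comm, Finset.sum_sdiff hFG]
    _ ≤ _ := hsum _ _

/-- The Kadec property of `ℓ¹`: if finitely many coordinates of `y` and the norm of `y` are close
to those of `x`, then little mass of `y` is left outside these coordinates. -/
theorem exists_finset_kadec {ι E : Type*} [NormedAddCommGroup E] [NormedSpace ℝ E]
    [DecidableEq ι] {d : ι → E} {c : ι → StrongDual ℝ E}
    (hc : ∀ t s, c t (d s) = if s = t then 1 else 0) (hd : ∀ t, ‖d t‖ ≤ 1)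
    (hsum : ∀ (F : Finset ι) (a : ι → ℝ), ∑ t ∈ F, |a t| ≤ ‖∑ t ∈ F, a t • d t‖)
    (hdense : ∀ y : E, y ∈ closure (Submodule.span ℝ (Set.range d) : Set E))
    (x : E) {ε : ℝ} (hε : 0 < ε) :
    ∃ F : Finset ι, ∃ δ > 0, ∀ y, ∑ t ∈ F, |c t y - c t x| < δ → |‖y‖ - ‖x‖| < δ →
      ‖x - y‖ < ε := by
  have hnorm := fun F y => sum_abs_add_norm_sub_le hc hd hsum F (hdense y)
  obtain ⟨s, hs, hxs⟩ := SeminormedAddCommGroup.mem_closure_iff.1 (hdense x) (ε / 6) (by linarith)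
  obtain ⟨a, rfl⟩ := Finsupp.mem_span_range_iff_exists_finsupp.1 hs
  have ha : (a.sum fun t r => r • d t) = ∑ t ∈ a.support, a t • d t := rfl
  rw [ha] at hxs
  generalize a.support = F at hxs
  have hx : ‖x - ∑ t ∈ F, c t x • d t‖ < ε / 6 := by
    have h1 := hnorm F (x - ∑ t ∈ F, a t • d t)
    have h2 : x - ∑ t ∈ F, a t • d t - ∑ t ∈ F, c t (x - ∑ t ∈ F, a t • d t) • d t =
        x - ∑ t ∈ F, c t x • d t := by
      have : ∑ t ∈ F, c t (x - ∑ t ∈ F, a t • d t) • d t =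
          ∑ t ∈ F, (c t x • d t - a t • d t) :=
        Finset.sum_congr rfl fun t ht => by
          rw [map_sub, sub_smul]
          simp [map_sum, hc, ht]
      rw [this, Finset.sum_sub_distrib]
      abel
    rw [h2] at h1
    have h3 : 0 ≤ ∑ t ∈ F, |c t (x - ∑ t ∈ F, a t • d t)| :=
      Finset.sum_nonneg fun _ _ => abs_nonneg _
    linarith
  -- With `P` the projection onto the coordinates in `F`, the norms of `x - P x` and `P x - P y`
  -- are below `ε / 6`, and that of `y - P y` is below `3 * ε / 6`.
  refine ⟨F, ε / 6, by linarith, fun y hy hyn => ?_⟩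
  have h1 := hnorm F y
  have h2 : ‖∑ t ∈ F, (c t y - c t x) • d t‖ < ε / 6 :=
    (norm_sum_smul_le_sum_abs hd _ _).trans_lt hy
  have h3 : ∑ t ∈ F, |c t x| ≤ ∑ t ∈ F, |c t y| + ∑ t ∈ F, |c t y - c t x| := by
    rw [← Finset.sum_add_distrib]
    refine Finset.sum_le_sum fun t _ => ?_
    have := abs_sub_abs_le_abs_sub (c t x) (c t y)
    rw [abs_sub_comm (c t x)] at this
    linarith
  have h4 := norm_sum_smul_le_sum_abs hd F fun t => c t x
  have h5 : ‖x‖ ≤ ‖x - ∑ t ∈ F, c t x • d t‖ + ‖∑ t ∈ F, c t x • d t‖ := by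
    simpa using norm_add_le (x - ∑ t ∈ F, c t x • d t) (∑ t ∈ F, c t x • d t)
  have e : x - y = (x - ∑ t ∈ F, c t x • d t) - ∑ t ∈ F, (c t y - c t x) • d t -
      (y - ∑ t ∈ F, c t y • d t) := by
    simp only [sub_smul, Finset.sum_sub_distrib]
    abel
  have h6 : ‖x - y‖ ≤ ‖x - ∑ t ∈ F, c t x • d t‖ + ‖∑ t ∈ F, (c t y - c t x) • d t‖ +
      ‖y - ∑ t ∈ F, c t y • d t‖ := by
    rw [e]
    exact (norm_sub_le _ _).trans (by gcongr; exact norm_sub_le _ _)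
  linarith [(abs_lt.1 hyn).2]

/-! ### Borel sets of the three topologies -/

open Set Topology MeasureTheory in
/-- A norm-open set is a countable union, over rational `q < r`, of sets
`V ∩ {y | q < ‖y‖ ≤ r}` with `V` open in `τ`, and such shells are `τ`-Borel. -/
theorem borel_eq_of_kadec {E : Type*} [NormedAddCommGroup E] (τ : TopologicalSpace E)
    (hle : UniformSpace.toTopologicalSpace ≤ τ)
    (hball : ∀ r : ℝ, IsClosed[τ] {x : E | ‖x‖ ≤ r})
    (hkadec : ∀ x : E, ∀ ε > 0, ∃ V : Set E, IsOpen[τ] V ∧ x ∈ V ∧ ∃ δ > 0,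
      ∀ y ∈ V, |‖y‖ - ‖x‖| < δ → ‖x - y‖ < ε) :
    @borel E τ = @borel E UniformSpace.toTopologicalSpace := by
  refine le_antisymm (borel_anti hle) ?_
  refine MeasurableSpace.generateFrom_le fun U hU => ?_
  let A : ℚ × ℚ → Set E := fun p => {y | (p.1 : ℝ) < ‖y‖ ∧ ‖y‖ ≤ p.2}
  have hA : ∀ p, MeasurableSet[@borel E τ] (A p) := by
    intro p
    have hm : ∀ r : ℝ, MeasurableSet[@borel E τ] {x : E | ‖x‖ ≤ r} := fun r => by
      have := MeasurableSpace.measurableSet_generateFrom (s := {s | IsOpen[τ] s})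
        (@IsClosed.isOpen_compl _ τ _ (hball r))
      exact @MeasurableSet.of_compl _ _ (@borel E τ) this
    have : A p = {x : E | ‖x‖ ≤ p.1}ᶜ ∩ {x : E | ‖x‖ ≤ p.2} := by
      ext y; simp [A]
    rw [this]
    exact (hm _).compl.inter (hm _)
  let V : ℚ × ℚ → Set E := fun p => ⋃₀ {V | IsOpen[τ] V ∧ V ∩ A p ⊆ U}
  have hV : ∀ p, MeasurableSet[@borel E τ] (V p) := fun p =>
    MeasurableSpace.measurableSet_generateFrom (@isOpen_sUnion _ τ _ fun W hW => hW.1)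
  have e : U = ⋃ p, V p ∩ A p := by
    apply Subset.antisymm
    · intro x hx
      obtain ⟨ε, hε, hεU⟩ := Metric.isOpen_iff.1 hU x hx
      obtain ⟨W, hW, hxW, δ, hδ, h⟩ := hkadec x ε hε
      obtain ⟨q, hq1, hq2⟩ := exists_rat_btwn (show ‖x‖ - δ < ‖x‖ by linarith)
      obtain ⟨r, hr1, hr2⟩ := exists_rat_btwn (show ‖x‖ < ‖x‖ + δ by linarith)
      refine mem_iUnion.2 ⟨(q, r), ⟨W, ⟨hW, ?_⟩, hxW⟩, hq2, hr1.le⟩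
      rintro y ⟨hyW, hy1, hy2⟩
      refine hεU ?_
      rw [Metric.mem_ball, dist_comm, dist_eq_norm]
      refine h y hyW ?_
      rw [abs_lt]
      constructor <;> dsimp only at hy1 hy2 <;> linarith
    · refine iUnion_subset fun p => ?_
      rintro y ⟨⟨W, hW, hyW⟩, hyA⟩
      exact hW.2 ⟨hyW, hyA⟩
  rw [e]
  exact MeasurableSet.iUnion fun p => (hV p).inter (hA p)

open Topology in
theorem continuous_weakTopology_apply {K : Type*} [TopologicalSpace K] [CompactSpace K]
    (c : StrongDual ℝ (DualCK K)) : Continuous[weakTopology K, _] c := by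
  have h : Continuous fun y : WeakSpace ℝ (DualCK K) => topDualPairing ℝ (DualCK K) c y :=
    WeakBilin.eval_continuous (topDualPairing ℝ (DualCK K)).flip c
  exact @Continuous.comp (DualCK K) (WeakSpace ℝ (DualCK K)) ℝ (weakTopology K) _ _
    (toWeakSpace ℝ (DualCK K)) _ h continuous_induced_dom

theorem normTopology_le_weakTopology {K : Type*} [TopologicalSpace K] [CompactSpace K] :
    normTopology K ≤ weakTopology K :=
  continuous_iff_le_induced.1 (toWeakSpaceCLM ℝ (DualCK K)).continuous

theorem weakTopology_le_weakStarTopology {K : Type*} [TopologicalSpace K] [CompactSpace K] :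
    weakTopology K ≤ weakStarTopology K :=
  continuous_iff_le_induced.1 <|
    @WeakDual.continuous_of_continuous_eval _ _ _ _ _ _ _ _ _ _ (weakTopology K) _ fun g =>
      continuous_weakTopology_apply (ContinuousLinearMap.apply ℝ ℝ g)

open Topology in
theorem continuous_weakStarTopology_pointEval {K : Type*} [TopologicalSpace K] [CompactSpace K] :
    Continuous[_, weakStarTopology K] (pointEval : K → DualCK K) :=
  continuous_induced_rng.2 <| WeakDual.continuous_of_continuous_eval fun g => g.continuous

open Topology in
theorem isClosed_weakTopology_norm_le {K : Type*} [TopologicalSpace K] [CompactSpace K] (r : ℝ) :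
    IsClosed[weakTopology K] {φ : DualCK K | ‖φ‖ ≤ r} := by
  have h := @IsClosed.preimage _ _ (weakStarTopology K) _ _ continuous_induced_dom _
    (WeakDual.isClosed_closedBall (𝕜 := ℝ) (E := C(K, ℝ)) 0 r)
  refine @IsClosed.mono _ (weakTopology K) (weakStarTopology K) _ ?_
    weakTopology_le_weakStarTopology
  convert h using 1
  ext φ
  simp

open Topology in
theorem borel_weakTopology_eq_borel_normTopology {K : Type*} [τ : TopologicalSpace K]
    [CompactSpace K] [T2Space K] (hK : ∀ A : Set K, @MeasurableSet K (Bo K τ) A) :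
    Bo (DualCK K) (weakTopology K) = Bo (DualCK K) (normTopology K) := by
  classical
  choose c hc using exists_bidual_apply_pointEval (K := K)
  refine borel_eq_of_kadec (weakTopology K) normTopology_le_weakTopology
    isClosed_weakTopology_norm_le fun x ε hε => ?_
  obtain ⟨F, δ, hδ, h⟩ := exists_finset_kadec hc norm_pointEval_le sum_abs_le_norm_sum_pointEval
    (mem_closure_span_pointEval hK) x hε
  refine ⟨{y | ∑ t ∈ F, |c t y - c t x| < δ}, ?_, by simpa using hδ, δ, hδ, h⟩
  let : TopologicalSpace (DualCK K) := weakTopology K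
  refine isOpen_lt (continuous_finsetSum _ fun t _ => ?_) continuous_const
  exact ((continuous_weakTopology_apply (c t)).sub continuous_const).abs

open Topology in
/-- The weakly open set `⋃ t ∈ A, {φ | c t φ ≠ 0}`, where `c t` is a coordinate functional at `t`,
contains exactly those `δ_s` with `s ∈ A`. -/
theorem measurableSet_of_borel_weakStarTopology_eq {K : Type*} [τ : TopologicalSpace K]
    [CompactSpace K] [T2Space K]
    (h : Bo (DualCK K) (weakStarTopology K) = Bo (DualCK K) (weakTopology K)) (A : Set K) :
    @MeasurableSet K (Bo K τ) A := by
  classical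
  choose c hc using exists_bidual_apply_pointEval (K := K)
  have hopen : IsOpen[weakTopology K] (⋃ t ∈ A, c t ⁻¹' {0}ᶜ) :=
    @isOpen_biUnion _ _ (weakTopology K) _ _ fun t _ =>
      @IsOpen.preimage _ _ (weakTopology K) _ _ (continuous_weakTopology_apply (c t)) _
        isOpen_compl_singleton
  have hmeas : @MeasurableSet _ (Bo (DualCK K) (weakStarTopology K)) (⋃ t ∈ A, c t ⁻¹' {0}ᶜ) := by
    rw [h]
    exact MeasurableSpace.measurableSet_generateFrom hopen
  have hδ : @Measurable _ _ (Bo K τ) (Bo (DualCK K) (weakStarTopology K)) pointEval :=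
    @Continuous.borel_measurable _ _ _ (weakStarTopology K) _ continuous_weakStarTopology_pointEval
  convert hδ hmeas using 1
  ext s
  simp [hc]

theorem mainTheorem2 (K : Type*) [τ : TopologicalSpace K] [CompactSpace K] [T2Space K] :
    ((∀ A : Set K, @MeasurableSet K (Bo K τ) A) →
      Bo (DualCK K) (weakTopology K) = Bo (DualCK K) (normTopology K)) ∧
    (Bo (DualCK K) (weakStarTopology K) = Bo (DualCK K) (weakTopology K) →
      Bo (DualCK K) (weakStarTopology K) = Bo (DualCK K) (normTopology K)) ∧
    (Bo (DualCK K) (weakStarTopology K) = Bo (DualCK K) (normTopology K) →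
      ∀ A : Set K, @MeasurableSet K (Bo K τ) A) := by
  refine ⟨borel_weakTopology_eq_borel_normTopology, fun h => ?_, fun h => ?_⟩
  · exact h.trans
      (borel_weakTopology_eq_borel_normTopology (measurableSet_of_borel_weakStarTopology_eq h))
  · refine measurableSet_of_borel_weakStarTopology_eq (le_antisymm ?_ ?_)
    · exact borel_anti weakTopology_le_weakStarTopology
    · rw [h]
      exact borel_anti normTopology_le_weakTopology
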